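/- Let $n\ge 1$, let $F:[0,+\infty)\to\mathbb R$ be a continuous function bounded from below, and let $\omega\subset\mathbb R^n$ be a measurable set with positive Lebesgue measure. Put $$M^F_k=\sup_{r\ge 0} r^k e^{-F(r)},\qquad k\ge 0,$$ and assume that $0<M_k^F<+\infty$ for all $k\ge0$ and that the sequence $\mathcal M^F=(M^F_k)_{k\ge0}$ is quasi-analytic, meaning that for all real numbers $a<b$, every function $f\in C^\infty([a,b],\mathbb C)$ which satisfies $|f^{(k)}(x)|\le M^F_k$ for all $k\ge 0$ and $x\in[a,b]$, and for which there is a point $x_0\in[a,b]$ with $f^{(k)}(x_0)=0$ for all $k\ge0$, is identically zero on $[a,b]$. Consider the control system $$(E_F)\qquad \partial_t f(t,x)+F(|D_x|)f(t,x)=h(t,x)\mathbf 1_\omega(x),\quad t>0,\ x\in\mathbb R^n,\qquad f(0,\cdot)=f_0\in L^2(\mathbb R^n),$$ where $D_x=-i\nabla_x$ and $F(|D_x|)$ is the Fourier multiplier with symbol $F(|\xi|)$. Its mild solution is the function $f\in C([0,T];L^2(\mathbb R^n))$ given by $$f(t)=e^{-tF(|D_x|)}f_0+\int_0^t e^{-(t-s)F(|D_x|)}\big(\mathbf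 1_\omega h(s)\big)\,ds .$$ Then, for every $T>0$, the system $(E_F)$ is approximately null-controllable from $\omega$ in time $T$: for all $\varepsilon>0$ and all $f_0\in L^2(\mathbb R^n)$, there exists a control $h\in L^2((0,T)\times\omega)$ such that the mild solution of $(E_F)$ satisfies $\|f(T,\cdot)\|_{L^2(\mathbb R^n)}\le\varepsilon$. -/

import Mathlib

open MeasureTheory Set
open scoped NNReal ENNReal FourierTransform

noncomputable section

namespace DiffusiveControl

/-- The space `L²(ℝⁿ; ℂ)`. -/
abbrev L2 (n : ℕ) : Type :=
  Lp (α := EuclideanSpace ℝ (Fin n)) ℂ 2 volume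

/-- The space `L²(ω; ℂ)`. -/
abbrev L2On {n : ℕ} (ω : Set (EuclideanSpace ℝ (Fin n))) : Type :=
  Lp (α := EuclideanSpace ℝ (Fin n)) ℂ 2 (volume.restrict ω)

/-- The number `M_k = sup_{r ≥ 0} r ^ k * exp (-F r)`. It is the true supremum when the set of these
values is bounded above. -/
def weightSeq (F : ℝ≥0 → ℝ) (k : ℕ) : ℝ :=
  ⨆ r : ℝ≥0, (r : ℝ) ^ k * Real.exp (-F r)

/-- All the suprema `sup_{r ≥ 0} r ^ k * exp (-F r)` are finite and positive. -/
def HasPositiveRealWeightSeq (F : ℝ≥0 → ℝ) : Prop :=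
  ∀ k : ℕ, BddAbove (range fun r : ℝ≥0 => (r : ℝ) ^ k * Real.exp (-F r)) ∧ 0 < weightSeq F k

/-- Membership in the Denjoy-Carleman class on `[a, b]`: `f` is smooth on `[a, b]` (one-sidedly at the
end points) and `|f^(k)| ≤ M_k` on `[a, b]` for all `k`. -/
def InDenjoyCarlemanClass (M : ℕ → ℝ) (a b : ℝ) (f : ℝ → ℂ) : Prop :=
  ContDiffOn ℝ ((⊤ : ℕ∞) : WithTop ℕ∞) f (Icc a b) ∧
    ∀ k : ℕ, ∀ x ∈ Icc a b, ‖iteratedDerivWithin k f (Icc a b) x‖ ≤ M k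

/-- A sequence is quasi-analytic when, for all `a < b`, a function of the Denjoy-Carleman class on
`[a, b]` all of whose derivatives vanish at some point of `[a, b]` is identically zero. -/
def IsQuasiAnalytic (M : ℕ → ℝ) : Prop :=
  ∀ a b : ℝ, a < b → ∀ f : ℝ → ℂ, InDenjoyCarlemanClass M a b f →
    (∃ x₀ ∈ Icc a b, ∀ k : ℕ, iteratedDerivWithin k f (Icc a b) x₀ = 0) →
    ∀ x ∈ Icc a b, f x = 0

/-- The symbol `exp (-t F(|ξ|))` of `exp (-t F(|D|))`, `D = -i∇`. Mathlib's Fourier transform has the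
kernel `exp (-2πi x·ξ)`, so that `D` corresponds to multiplication by `2πξ`. -/
def symbol {n : ℕ} (F : ℝ≥0 → ℝ) (t : ℝ) (ξ : EuclideanSpace ℝ (Fin n)) : ℂ :=
  (Real.exp (-t * F ‖(2 * Real.pi) • ξ‖₊) : ℝ)

/-- For `t ≥ 0` and `F` continuous and bounded from below, the symbol acts on all of `L²`. -/
theorem memLp_symbol_mul {n : ℕ} {F : ℝ≥0 → ℝ} (hF : Continuous F) (hb : BddBelow (range F))
    {t : ℝ} (ht : 0 ≤ t) (u : L2 n) :
    MemLp (fun ξ : EuclideanSpace ℝ (Fin n) => symbol F t ξ * u ξ) 2 volume := by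
  obtain ⟨c, hc⟩ := hb
  have hs : Continuous (symbol F t : EuclideanSpace ℝ (Fin n) → ℂ) := by
    unfold symbol
    fun_prop
  refine MemLp.of_le_mul (c := Real.exp (-t * c)) (Lp.memLp u)
    (hs.aestronglyMeasurable.mul (Lp.aestronglyMeasurable u)) (Filter.Eventually.of_forall ?_)
  intro ξ
  rw [norm_mul]
  refine mul_le_mul_of_nonneg_right ?_ (norm_nonneg _)
  rw [symbol, Complex.norm_real, Real.norm_eq_abs, abs_of_pos (Real.exp_pos _)]
  refine Real.exp_le_exp.2 ?_
  have := mul_le_mul_of_nonneg_left (hc (mem_range_self ‖(2 * Real.pi) • ξ‖₊)) ht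
  linarith

open Classical in
/-- The operator `exp (-t F(|D|))` on `L²(ℝⁿ)`, as a Fourier multiplier. By `memLp_symbol_mul` the
second branch never occurs for `t ≥ 0` and `F` continuous and bounded from below. -/
def semigroup {n : ℕ} (F : ℝ≥0 → ℝ) (t : ℝ) (g : L2 n) : L2 n :=
  if h : MemLp (fun ξ : EuclideanSpace ℝ (Fin n) => symbol F t ξ * (𝓕 g : L2 n) ξ) 2 volume then
    𝓕⁻ (h.toLp _ : L2 n)
  else 0

theorem memLp_indicator {n : ℕ} {ω : Set (EuclideanSpace ℝ (Fin n))}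
    (hω : NullMeasurableSet ω volume) (u : L2On ω) :
    MemLp (ω.indicator u) 2 (volume : Measure (EuclideanSpace ℝ (Fin n))) := by
  refine ⟨(aestronglyMeasurable_indicator_iff₀ hω).2 (Lp.aestronglyMeasurable u), ?_⟩
  have h1 : ω.indicator u =ᵐ[volume] (toMeasurable volume ω).indicator u :=
    indicator_ae_eq_of_ae_eq_set hω.toMeasurable_ae_eq.symm
  rw [eLpNorm_congr_ae h1, eLpNorm_indicator_eq_eLpNorm_restrict (measurableSet_toMeasurable _ _),
    Measure.restrict_congr_set hω.toMeasurable_ae_eq]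
  exact (Lp.memLp u).2

/-- The function `1_ω u` on `ℝⁿ`, for `u ∈ L²(ω)`: extension by zero. -/
def extendByZero {n : ℕ} {ω : Set (EuclideanSpace ℝ (Fin n))}
    (hω : NullMeasurableSet ω volume) (u : L2On ω) : L2 n :=
  (memLp_indicator hω u).toLp _

/-- The space `L²((0,T) × ω)` of controls, as `L²((0,T); L²(ω))`. -/
abbrev Control {n : ℕ} (ω : Set (EuclideanSpace ℝ (Fin n))) (T : ℝ) : Type :=
  Lp (α := ℝ) (L2On ω) 2 (volume.restrict (Ioo 0 T))

/-- `f` is the mild solution on `[0, T]` of `∂ₜ f + F(|D|) f = h 1_ω`, `f(0) = f₀`: a continuous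
function with values in `L²(ℝⁿ)`, given by Duhamel's formula. -/
def IsMildSolution {n : ℕ} (F : ℝ≥0 → ℝ) {ω : Set (EuclideanSpace ℝ (Fin n))}
    (hω : NullMeasurableSet ω volume) (T : ℝ) (f₀ : L2 n) (h : Control ω T) (f : ℝ → L2 n) : Prop :=
  ContinuousOn f (Icc 0 T) ∧
    ∀ t ∈ Icc 0 T,
      IntervalIntegrable (fun s => semigroup F (t - s) (extendByZero hω (h s))) volume 0 t ∧
      f t = semigroup F t f₀ + ∫ s in (0 : ℝ)..t, semigroup F (t - s) (extendByZero hω (h s))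

/-- Approximate null-controllability from the control support `ω` in time `T`. -/
def ApproxNullControllable {n : ℕ} (F : ℝ≥0 → ℝ) {ω : Set (EuclideanSpace ℝ (Fin n))}
    (hω : NullMeasurableSet ω volume) (T : ℝ) : Prop :=
  ∀ ε : ℝ, 0 < ε → ∀ f₀ : L2 n, ∃ h : Control ω T, ∃ f : ℝ → L2 n,
    IsMildSolution F hω T f₀ h f ∧ ‖f T‖ ≤ ε

end DiffusiveControl

end

/-!
Write `S t = exp (-t F(|D|))`. The states reachable from `0` at time `T` by continuous controls form
a linear subspace of `L²(ℝⁿ)`, the range of `reachMap`. It suffices that this subspace is dense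
(`denseRange_reachMap`): a control steering `0` close to `-S T f₀` steers `f₀` close to `0`. The
Duhamel formula with a continuous control gives a continuous function of time because `S` is strongly
continuous (`continuous_uncurry_semigroupCLM`).

Density is a unique continuation property. If `g` is orthogonal to all reachable states, the control
`s ↦ 1_ω S (T - s) g` shows that `S t g` vanishes on `ω` for `t ∈ [0, T]`
(`inner_semigroupCLM_eq_zero_of_orthogonal`). For `v ∈ L²(ω)` the function `t ↦ ⟪1_ω v, S t g⟫` is
a Laplace-type integral, hence analytic for `t > 0`, so that `S t g` vanishes on `ω` for every `t > 0`
(`inner_semigroupCLM_eq_zero_of_Ioo`). The time `t = 2` can therefore be used whatever `T` is, and the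
quasi-analyticity of the weights of `t F` is needed for `t = 1` only.

The Fourier transform of `S 2 g` is `exp (-2 F) 𝓕 g`. One factor `exp (-F)` bounds `|ξ| ^ k` by
`M_k`, and the other one is in `L²`, so that `S 2 g` has a smooth representative `u` whose derivatives
of order `k` along the coordinate axes are at most `C * M_k`. If `u` vanishes on a set of positive
measure of a line parallel to an axis, then almost every point of this set is a zero of infinite
order, and quasi-analyticity gives `u = 0` on the line
(`IsQuasiAnalytic.eq_zero_of_volume_zeroSet_pos`). The zero set of `u` contains almost all of `ω`, and
by Fubini's theorem a closed set of positive measure with this propagation property is the whole space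
(`eq_univ_of_forall_update_mem`). Thus `u = 0`, and `g = 0` since the symbol has no zeros.
-/

noncomputable section

namespace DiffusiveControl

open Filter Topology
open scoped InnerProductSpace SchwartzMap

/-! ### Propagation of zeros along lines -/

/-- A closed set of positive measure in `ℝⁿ` is everything if it contains each line parallel to an
axis which it meets in a set of positive one-dimensional measure. By induction on `n`: positively many
slices `x 0 = t` have positive measure, hence are full, so that every line in direction `0` meets `Z`
in a set of positive measure. -/
theorem eq_univ_of_forall_update_mem (n : ℕ) (Z : Set (Fin n → ℝ)) (hZ : IsClosed Z)
    (hpos : 0 < volume Z)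
    (hsat : ∀ (x : Fin n → ℝ) (i : Fin n), 0 < volume {s : ℝ | Function.update x i s ∈ Z} →
      ∀ s, Function.update x i s ∈ Z) : Z = univ := by
  induction n with
  | zero =>
    obtain ⟨z, hz⟩ := nonempty_of_measure_ne_zero hpos.ne'
    exact eq_univ_of_forall fun x => Subsingleton.elim z x ▸ hz
  | succ n ih =>
    let e := MeasurableEquiv.piFinSuccAbove (fun _ : Fin (n + 1) => ℝ) 0
    have he : MeasurePreserving e := volume_preserving_piFinSuccAbove (fun _ => ℝ) 0
    have hcons : ∀ t y, e.symm (t, y) = Fin.cons t y := fun t y => by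
      simp only [e, MeasurableEquiv.piFinSuccAbove_symm_apply, Fin.insertNthEquiv_zero]
      rfl
    let W : Set (ℝ × (Fin n → ℝ)) := e.symm ⁻¹' Z
    have hW : MeasurableSet W := e.symm.measurable hZ.measurableSet
    have hWpos : volume W ≠ 0 := by
      rw [show volume W = volume Z from (he.symm e).measure_preimage_equiv Z]
      exact hpos.ne'
    have hA : volume {t : ℝ | volume (Prod.mk t ⁻¹' W) ≠ 0} ≠ 0 := by
      intro h
      refine hWpos ((Measure.measure_prod_null hW).2 ?_)
      exact h
    have hslice : ∀ t : ℝ, volume (Prod.mk t ⁻¹' W) ≠ 0 → ∀ y, Fin.cons t y ∈ Z := by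
      intro t ht
      have hS : Prod.mk t ⁻¹' W = {y | (Fin.cons t y : Fin (n + 1) → ℝ) ∈ Z} := by
        ext y
        simp only [W, mem_preimage, hcons, mem_ofPred_eq]
      rw [hS] at ht
      have := ih {y | (Fin.cons t y : Fin (n + 1) → ℝ) ∈ Z}
        (hZ.preimage (by fun_prop)) (pos_iff_ne_zero.2 ht) (fun x i h s => by
          simp only [mem_ofPred_eq, Fin.cons_update] at h ⊢
          exact hsat _ _ h s)
      intro y
      exact (Set.ext_iff.1 this y).2 (mem_univ y)
    refine eq_univ_of_forall fun x => ?_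
    have key : ∀ s, Function.update x 0 s ∈ Z := by
      refine hsat x 0 (lt_of_lt_of_le (pos_iff_ne_zero.2 hA) (measure_mono fun t ht => ?_))
      have := hslice t ht (Fin.tail x)
      rwa [← Fin.cons_self_tail x, mem_ofPred_eq, Fin.update_cons_zero]
    simpa using key (x 0)

/-- If a smooth function, given with its derivatives `G k`, vanishes on a set of positive measure, then
it has a zero of infinite order: the zeros of `G k` at which `G (k + 1)` does not vanish are isolated,
hence countable in number. -/
theorem exists_forall_eq_zero_of_volume_zeroSet_pos (G : ℕ → ℝ → ℂ)
    (hG : ∀ k x, HasDerivAt (G k) (G (k + 1) x) x) (hpos : 0 < volume {x | G 0 x = 0}) :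
    ∃ x, ∀ k, G k x = 0 := by
  have hcount : ∀ k, {x | G k x = 0 ∧ G (k + 1) x ≠ 0}.Countable := by
    intro k
    refine (countable_setOfPred_isolated_right_within (s := {x | G k x = 0})).mono ?_
    rintro x ⟨hx0, hx1⟩
    refine ⟨hx0, ?_⟩
    rw [← Filter.empty_mem_iff_bot]
    have h1 : ∀ᶠ z in 𝓝[≠] x, G k z ≠ 0 := (hG k x).eventually_ne hx1
    have h2 : ∀ᶠ z in 𝓝[{x | G k x = 0} ∩ Ioi x] x, G k z ≠ 0 :=
      h1.filter_mono (nhdsWithin_mono _ fun z hz => ne_of_gt hz.2)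
    filter_upwards [h2, self_mem_nhdsWithin] with z hz hz'
    exact hz hz'.1
  have hae : ∀ᵐ x : ℝ, ∀ k, G k x = 0 → G (k + 1) x = 0 := by
    refine ae_all_iff.2 fun k => ?_
    filter_upwards [(hcount k).ae_notMem volume] with x hx h0
    by_contra h1
    exact hx ⟨h0, h1⟩
  obtain ⟨x, hx0, hx⟩ : ∃ x, x ∈ {x | G 0 x = 0} ∧ ∀ k, G k x = 0 → G (k + 1) x = 0 := by
    by_contra! hcon
    refine hpos.ne' (measure_mono_null (fun x hx => ?_) hae)
    obtain ⟨k, hk⟩ := hcon x hx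
    exact fun h => hk.2 (h k hk.1)
  exact ⟨x, fun k => Nat.rec hx0 (fun k ih => hx k ih) k⟩

theorem IsQuasiAnalytic.eq_zero_of_volume_zeroSet_pos {M : ℕ → ℝ} (hM : IsQuasiAnalytic M)
    (G : ℕ → ℝ → ℂ) (hG : ∀ k x, HasDerivAt (G k) (G (k + 1) x) x)
    (hbound : ∀ k x, ‖G k x‖ ≤ M k) (hpos : 0 < volume {x | G 0 x = 0}) (x : ℝ) :
    G 0 x = 0 := by
  obtain ⟨x₀, hx₀⟩ := exists_forall_eq_zero_of_volume_zeroSet_pos G hG hpos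
  have hiter : ∀ k, iteratedDeriv k (G 0) = G k := by
    intro k
    induction k with
    | zero => exact iteratedDeriv_zero
    | succ k ih =>
      rw [iteratedDeriv_succ, ih]
      exact funext fun y => (hG k y).deriv
  have hsmooth : ContDiff ℝ ((⊤ : ℕ∞) : WithTop ℕ∞) (G 0) := by
    refine contDiff_of_differentiable_iteratedDeriv fun k _ => ?_
    rw [hiter]
    exact fun y => (hG k y).differentiableAt
  have hab : min x x₀ - 1 < max x x₀ + 1 := by
    have := min_le_max (a := x) (b := x₀)
    linarith
  have hwithin : ∀ k, ∀ y ∈ Icc (min x x₀ - 1) (max x x₀ + 1),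
      iteratedDerivWithin k (G 0) (Icc (min x x₀ - 1) (max x x₀ + 1)) y = G k y := by
    intro k y hy
    rw [iteratedDerivWithin_eq_iteratedDeriv (uniqueDiffOn_Icc hab)
      (hsmooth.of_le (by exact_mod_cast le_top)).contDiffAt hy, hiter]
  have hmem : x ∈ Icc (min x x₀ - 1) (max x x₀ + 1) :=
    ⟨by linarith [min_le_left x x₀], by linarith [le_max_left x x₀]⟩
  have hmem₀ : x₀ ∈ Icc (min x x₀ - 1) (max x x₀ + 1) :=
    ⟨by linarith [min_le_right x x₀], by linarith [le_max_right x x₀]⟩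
  refine hM _ _ hab (G 0) ⟨hsmooth.contDiffOn, fun k y hy => ?_⟩ ⟨x₀, hmem₀, fun k => ?_⟩ x hmem
  · rw [hwithin k y hy]
    exact hbound k y
  · rw [hwithin k x₀ hmem₀, hx₀ k]

/-! ### Analyticity of Laplace-type integrals -/

/-- The integral of `exp (-z φ) m` is holomorphic in `Re z > 0` when `φ` is bounded from below: there
`|φ| exp (-Re z φ)` is bounded, locally uniformly in `z`. -/
theorem differentiableOn_integral_exp_neg_mul {α : Type*} [MeasurableSpace α] {μ : Measure α}
    {φ : α → ℝ} (hφ : Measurable φ) {c : ℝ} (hc : ∀ x, c ≤ φ x) {m : α → ℂ}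
    (hm : Integrable m μ) :
    DifferentiableOn ℂ (fun z : ℂ => ∫ x, Complex.exp (-z * φ x) * m x ∂μ) {z | 0 < z.re} := by
  intro z₀ hz₀
  have hz₀ : 0 < z₀.re := hz₀
  refine DifferentiableAt.differentiableWithinAt ?_
  set δ := z₀.re / 2 with hδ
  have hδ0 : 0 < δ := by positivity
  set s : Set ℂ := {z | δ < z.re ∧ z.re < z₀.re + 1} with hs
  have hs_open : IsOpen s :=
    (isOpen_lt continuous_const Complex.continuous_re).inter
      (isOpen_lt Complex.continuous_re continuous_const)
  have hs_mem : s ∈ 𝓝 z₀ := hs_open.mem_nhds ⟨by linarith, by linarith⟩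
  have hexp : ∀ z ∈ s, ∀ x, ‖Complex.exp (-z * φ x)‖ ≤ Real.exp ((z₀.re + 1) * |c|) := by
    intro z hz x
    have hz' : 0 < z.re := hδ0.trans hz.1
    rw [Complex.norm_exp]
    refine Real.exp_le_exp.2 ?_
    have h1 : (-z * (φ x : ℂ)).re = -(z.re * φ x) := by simp
    rw [h1]
    have h2 : z.re * -φ x ≤ z.re * |c| :=
      mul_le_mul_of_nonneg_left (by linarith [hc x, neg_abs_le c]) hz'.le
    have h3 : z.re * |c| ≤ (z₀.re + 1) * |c| := mul_le_mul_of_nonneg_right hz.2.le (abs_nonneg c)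
    linarith
  -- For `φ x ≥ 0` the bound `y exp (-y) ≤ 1` is used at `y = δ φ x`; for `φ x < 0`, `|φ x| ≤ |c|`.
  have hexp' : ∀ z ∈ s, ∀ x,
      ‖Complex.exp (-z * φ x)‖ * |φ x| ≤ δ⁻¹ + |c| * Real.exp ((z₀.re + 1) * |c|) := by
    intro z hz x
    have hz' : 0 < z.re := hδ0.trans hz.1
    have hE0 : (0 : ℝ) ≤ |c| * Real.exp ((z₀.re + 1) * |c|) := by positivity
    rcases le_or_gt 0 (φ x) with h0 | h0
    · have h1 : ‖Complex.exp (-z * φ x)‖ ≤ Real.exp (-(δ * φ x)) := by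
        rw [Complex.norm_exp]
        refine Real.exp_le_exp.2 ?_
        have h1 : (-z * (φ x : ℂ)).re = -(z.re * φ x) := by simp
        rw [h1]
        exact neg_le_neg (mul_le_mul_of_nonneg_right hz.1.le h0)
      have h2 : Real.exp (-(δ * φ x)) * (δ * φ x) ≤ 1 := by
        rw [Real.exp_neg, inv_mul_le_iff₀ (Real.exp_pos _), mul_one]
        linarith [Real.add_one_le_exp (δ * φ x)]
      have h3 : Real.exp (-(δ * φ x)) * φ x ≤ δ⁻¹ := by
        rw [← one_mul δ⁻¹, ← div_eq_mul_inv, le_div_iff₀ hδ0]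
        linarith
      rw [abs_of_nonneg h0]
      linarith [mul_le_mul_of_nonneg_right h1 h0]
    · have h1 : |φ x| ≤ |c| := by
        rw [abs_of_neg h0]
        linarith [hc x, neg_abs_le c]
      have := mul_le_mul (hexp z hz x) h1 (abs_nonneg _) (Real.exp_pos _).le
      have : 0 < δ⁻¹ := inv_pos.2 hδ0
      linarith
  have hmeas : ∀ z : ℂ, AEStronglyMeasurable (fun x => Complex.exp (-z * φ x) * m x) μ := fun z =>
    (Measurable.aestronglyMeasurable (by fun_prop)).mul hm.1
  refine (hasDerivAt_integral_of_dominated_loc_of_deriv_le (μ := μ)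
    (F := fun (z : ℂ) x => Complex.exp (-z * φ x) * m x)
    (F' := fun (z : ℂ) x => Complex.exp (-z * φ x) * (-(φ x : ℂ)) * m x)
    (bound := fun x => (δ⁻¹ + |c| * Real.exp ((z₀.re + 1) * |c|)) * ‖m x‖) hs_mem
    (Eventually.of_forall hmeas) ?_ ?_ ?_ (hm.norm.const_mul _) ?_).2.differentiableAt
  · refine (hm.norm.const_mul (Real.exp ((z₀.re + 1) * |c|))).mono' (hmeas z₀) ?_
    refine Eventually.of_forall fun x => ?_
    rw [norm_mul]
    exact mul_le_mul_of_nonneg_right (hexp z₀ (mem_of_mem_nhds hs_mem) x) (norm_nonneg _)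
  · exact (Measurable.aestronglyMeasurable (by fun_prop)).mul hm.1
  · refine Eventually.of_forall fun x z hz => ?_
    rw [norm_mul, norm_mul, norm_neg, Complex.norm_real, Real.norm_eq_abs]
    exact mul_le_mul_of_nonneg_right (hexp' z hz x) (norm_nonneg _)
  · refine Eventually.of_forall fun x z _ => ?_
    have h1 : HasDerivAt (fun z : ℂ => -z * φ x) (-(φ x : ℂ)) z := by
      simpa using (hasDerivAt_id z).neg.mul_const (φ x : ℂ)
    exact h1.cexp.mul_const (m x)

theorem integral_exp_neg_mul_eq_zero {α : Type*} [MeasurableSpace α] {μ : Measure α}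
    {φ : α → ℝ} (hφ : Measurable φ) {c : ℝ} (hc : ∀ x, c ≤ φ x) {m : α → ℂ}
    (hm : Integrable m μ) {T : ℝ} (hT : 0 < T)
    (h : ∀ t ∈ Ioo 0 T, ∫ x, ((Real.exp (-t * φ x) : ℝ) : ℂ) * m x ∂μ = 0) {t : ℝ} (ht : 0 < t) :
    ∫ x, ((Real.exp (-t * φ x) : ℝ) : ℂ) * m x ∂μ = 0 := by
  set Φ : ℂ → ℂ := fun z => ∫ x, Complex.exp (-z * φ x) * m x ∂μ with hΦ
  have hΦt : ∀ t : ℝ, Φ t = ∫ x, ((Real.exp (-t * φ x) : ℝ) : ℂ) * m x ∂μ := fun t => by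
    simp [hΦ]
  have hopen : IsOpen {z : ℂ | 0 < z.re} := isOpen_lt continuous_const Complex.continuous_re
  have han : AnalyticOnNhd ℂ Φ {z | 0 < z.re} :=
    (differentiableOn_integral_exp_neg_mul hφ hc hm).analyticOnNhd hopen
  have hmem : ((T / 2 : ℝ) : ℂ) ∈ {z : ℂ | 0 < z.re} := by
    simp only [mem_ofPred_eq, Complex.ofReal_re]
    positivity
  have hfreq : ∃ᶠ z in 𝓝[≠] ((T / 2 : ℝ) : ℂ), Φ z = 0 := by
    have hreal : ∀ᶠ r : ℝ in 𝓝[≠] (T / 2), Φ r = 0 := by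
      have : Ioo 0 T ∈ 𝓝 (T / 2) := Ioo_mem_nhds (by linarith) (by linarith)
      filter_upwards [mem_nhdsWithin_of_mem_nhds this] with r hr
      rw [hΦt, h r hr]
    have htend : Tendsto (fun r : ℝ => (r : ℂ)) (𝓝[≠] (T / 2)) (𝓝[≠] ((T / 2 : ℝ) : ℂ)) := by
      refine tendsto_nhdsWithin_iff.2
        ⟨(Complex.continuous_ofReal.tendsto _).mono_left nhdsWithin_le_nhds, ?_⟩
      filter_upwards [self_mem_nhdsWithin] with r hr
      exact fun h => hr (Complex.ofReal_injective h)
    exact htend.frequently hreal.frequently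
  have := han.eqOn_zero_of_preconnected_of_frequently_eq_zero
    (convex_halfSpace_re_gt 0).isPreconnected hmem hfreq
    (show (t : ℂ) ∈ {z : ℂ | 0 < z.re} by simpa using ht)
  rw [← hΦt]
  exact this

variable {n : ℕ} {F : ℝ≥0 → ℝ}

/-! ### The semigroup as a strongly continuous family of bounded operators -/

theorem continuous_symbol (hF : Continuous F) (t : ℝ) :
    Continuous (symbol F t : EuclideanSpace ℝ (Fin n) → ℂ) := by
  unfold symbol
  fun_prop

theorem norm_symbol (t : ℝ) (ξ : EuclideanSpace ℝ (Fin n)) :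
    ‖symbol F t ξ‖ = Real.exp (-t * F ‖(2 * Real.pi) • ξ‖₊) := by
  rw [symbol, Complex.norm_real, Real.norm_eq_abs, abs_of_pos (Real.exp_pos _)]

theorem norm_symbol_le {c : ℝ} (hc : c ∈ lowerBounds (range F)) {t : ℝ} (ht : 0 ≤ t)
    (ξ : EuclideanSpace ℝ (Fin n)) : ‖symbol F t ξ‖ ≤ Real.exp (t * |c|) := by
  rw [norm_symbol]
  refine Real.exp_le_exp.2 ?_
  have h1 : -F ‖(2 * Real.pi) • ξ‖₊ ≤ |c| := by
    linarith [hc (mem_range_self ‖(2 * Real.pi) • ξ‖₊), neg_abs_le c]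
  linarith [mul_le_mul_of_nonneg_left h1 ht]

/-- Multiplication by the symbol at time `max t 0`, as a bounded operator on `L²`. The truncation of
the time makes the family of operators defined and strongly continuous on all of `ℝ`. -/
def symbolMul (hF : Continuous F) (hb : BddBelow (range F)) (t : ℝ) : L2 n →L[ℂ] L2 n :=
  LinearMap.mkContinuousOfExistsBound
    { toFun := fun u => (memLp_symbol_mul hF hb (le_max_right t 0) u).toLp _
      map_add' := fun u v => by
        rw [← MemLp.toLp_add]
        refine MemLp.toLp_congr _ _ ?_
        filter_upwards [Lp.coeFn_add u v] with ξ hξ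
        exact (congrArg _ hξ).trans (mul_add _ _ _)
      map_smul' := fun a u => by
        rw [RingHom.id_apply, ← MemLp.toLp_const_smul]
        refine MemLp.toLp_congr _ _ ?_
        filter_upwards [Lp.coeFn_smul a u] with ξ hξ
        exact (congrArg _ hξ).trans (mul_left_comm _ _ _) }
    (by
      obtain ⟨c, hc⟩ := hb
      refine ⟨Real.exp (max t 0 * |c|), fun u => Lp.norm_le_mul_norm_of_ae_le_mul ?_⟩
      filter_upwards [(memLp_symbol_mul hF ⟨c, hc⟩ (le_max_right t 0) u).coeFn_toLp] with ξ hξ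
      refine (congrArg norm hξ).trans_le ?_
      rw [norm_mul]
      exact mul_le_mul_of_nonneg_right (norm_symbol_le hc (le_max_right t 0) ξ) (norm_nonneg _))

theorem coeFn_symbolMul (hF : Continuous F) (hb : BddBelow (range F)) (t : ℝ) (u : L2 n) :
    symbolMul hF hb t u =ᵐ[volume] fun ξ => symbol F (max t 0) ξ * u ξ :=
  (memLp_symbol_mul hF hb (le_max_right t 0) u).coeFn_toLp

theorem norm_symbolMul_le (hF : Continuous F) (hb : BddBelow (range F)) {c : ℝ}
    (hc : c ∈ lowerBounds (range F)) (t : ℝ) (u : L2 n) :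
    ‖symbolMul hF hb t u‖ ≤ Real.exp (max t 0 * |c|) * ‖u‖ := by
  refine Lp.norm_le_mul_norm_of_ae_le_mul ?_
  filter_upwards [coeFn_symbolMul hF hb t u] with ξ hξ
  rw [hξ, norm_mul]
  exact mul_le_mul_of_nonneg_right (norm_symbol_le hc (le_max_right t 0) ξ) (norm_nonneg _)

theorem inner_symbolMul (hF : Continuous F) (hb : BddBelow (range F)) (t : ℝ) (u v : L2 n) :
    ⟪u, symbolMul hF hb t v⟫_ℂ =
      ∫ ξ, ((Real.exp (-max t 0 * F ‖(2 * Real.pi) • ξ‖₊) : ℝ) : ℂ) * ⟪u ξ, v ξ⟫_ℂ := by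
  rw [L2.inner_def]
  refine integral_congr_ae ?_
  filter_upwards [coeFn_symbolMul hF hb t v] with ξ hξ
  rw [hξ, ← smul_eq_mul, inner_smul_right]
  rfl

theorem inner_symbolMul_left (hF : Continuous F) (hb : BddBelow (range F)) (t : ℝ) (u v : L2 n) :
    ⟪symbolMul hF hb t u, v⟫_ℂ = ⟪u, symbolMul hF hb t v⟫_ℂ := by
  rw [L2.inner_def, L2.inner_def]
  refine integral_congr_ae ?_
  filter_upwards [coeFn_symbolMul hF hb t u, coeFn_symbolMul hF hb t v] with ξ h1 h2
  rw [h1, h2, ← smul_eq_mul, ← smul_eq_mul, inner_smul_right, inner_smul_left, symbol,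
    Complex.conj_ofReal]

theorem continuous_symbolMul_apply (hF : Continuous F) (hb : BddBelow (range F)) (u : L2 n) :
    Continuous fun t => symbolMul hF hb t u := by
  obtain ⟨c, hc⟩ := id hb
  refine continuous_iff_continuousAt.2 fun t₀ => ?_
  -- The squared distance is an integral that depends continuously on `t` by dominated convergence.
  have hnorm : ∀ t, ‖symbolMul hF hb t u - symbolMul hF hb t₀ u‖ ^ 2 =
      ∫ ξ, (‖symbol F (max t 0) ξ - symbol F (max t₀ 0) ξ‖ * ‖u ξ‖) ^ 2 := by
    intro t
    rw [← inner_self_eq_norm_sq (𝕜 := ℂ), L2.inner_def, ← integral_re (L2.integrable_inner _ _)]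
    refine integral_congr_ae ?_
    filter_upwards [Lp.coeFn_sub (symbolMul hF hb t u) (symbolMul hF hb t₀ u),
      coeFn_symbolMul hF hb t u, coeFn_symbolMul hF hb t₀ u] with ξ h1 h2 h3
    rw [inner_self_eq_norm_sq, h1, Pi.sub_apply, h2, h3, ← sub_mul, norm_mul]
  have hsq : Integrable (fun ξ => ‖u ξ‖ ^ 2) (volume : Measure (EuclideanSpace ℝ (Fin n))) :=
    (memLp_two_iff_integrable_sq_norm (Lp.aestronglyMeasurable u)).1 (Lp.memLp u)
  set K : ℝ := Real.exp ((|t₀| + 1) * |c|) with hK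
  have hle : ∀ t, max t 0 ≤ |t₀| + 1 → ∀ ξ : EuclideanSpace ℝ (Fin n),
      ‖symbol F (max t 0) ξ‖ ≤ K := fun t ht ξ =>
    (norm_symbol_le hc (le_max_right t 0) ξ).trans
      (Real.exp_le_exp.2 (mul_le_mul_of_nonneg_right ht (abs_nonneg c)))
  have hmax₀ : max t₀ 0 ≤ |t₀| + 1 :=
    max_le (by linarith [le_abs_self t₀]) (by linarith [abs_nonneg t₀])
  have hcont : ContinuousAt (fun t => ∫ ξ : EuclideanSpace ℝ (Fin n),
      (‖symbol F (max t 0) ξ - symbol F (max t₀ 0) ξ‖ * ‖u ξ‖) ^ 2) t₀ := by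
    refine continuousAt_of_dominated (bound := fun ξ => (2 * K) ^ 2 * ‖u ξ‖ ^ 2)
      (Eventually.of_forall fun t => ?_) ?_ (hsq.const_mul _) (Eventually.of_forall fun ξ => ?_)
    · exact ((((continuous_symbol hF _).sub (continuous_symbol hF _)).norm.aestronglyMeasurable).mul
        (Lp.aestronglyMeasurable u).norm).pow 2
    · have hnear : ∀ᶠ t in 𝓝 t₀, t < |t₀| + 1 :=
        eventually_lt_nhds (by linarith [le_abs_self t₀])
      filter_upwards [hnear] with t ht
      refine Eventually.of_forall fun ξ => ?_
      rw [Real.norm_eq_abs, abs_of_nonneg (by positivity), mul_pow]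
      have h1 := hle t (max_le ht.le (by positivity)) ξ
      have h2 := hle t₀ hmax₀ ξ
      have h3 := norm_sub_le (symbol F (max t 0) ξ) (symbol F (max t₀ 0) ξ)
      gcongr
      linarith
    · unfold symbol
      fun_prop
  have h0 : Tendsto (fun t => ‖symbolMul hF hb t u - symbolMul hF hb t₀ u‖ ^ 2) (𝓝 t₀) (𝓝 0) := by
    have := hcont.tendsto
    simp only [← hnorm] at this
    simpa using this
  rw [ContinuousAt, tendsto_iff_norm_sub_tendsto_zero]
  have h1 := (Real.continuous_sqrt.tendsto 0).comp h0
  rw [Real.sqrt_zero] at h1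
  exact h1.congr fun t => Real.sqrt_sq (norm_nonneg _)

/-- The operator `exp (-t F(|D|))` at time `max t 0`, as a bounded operator on `L²`. -/
def semigroupCLM (hF : Continuous F) (hb : BddBelow (range F)) (t : ℝ) : L2 n →L[ℂ] L2 n :=
  ((Lp.fourierTransformₗᵢ (EuclideanSpace ℝ (Fin n)) ℂ).symm : L2 n →L[ℂ] L2 n) ∘L
    symbolMul hF hb t ∘L ((Lp.fourierTransformₗᵢ (EuclideanSpace ℝ (Fin n)) ℂ) : L2 n →L[ℂ] L2 n)

theorem semigroupCLM_apply (hF : Continuous F) (hb : BddBelow (range F)) (t : ℝ) (u : L2 n) :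
    semigroupCLM hF hb t u = 𝓕⁻ (symbolMul hF hb t (𝓕 u : L2 n)) :=
  rfl

theorem semigroup_eq_semigroupCLM (hF : Continuous F) (hb : BddBelow (range F)) {t : ℝ}
    (ht : 0 ≤ t) (u : L2 n) : semigroup F t u = semigroupCLM hF hb t u := by
  rw [semigroup, dif_pos (memLp_symbol_mul hF hb ht _), semigroupCLM_apply]
  congr 1
  refine MemLp.toLp_congr _ (memLp_symbol_mul hF hb (le_max_right t 0) _) ?_
  rw [max_eq_left ht]

theorem inner_semigroupCLM (hF : Continuous F) (hb : BddBelow (range F)) (t : ℝ) (u v : L2 n) :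
    ⟪u, semigroupCLM hF hb t v⟫_ℂ = ⟪(𝓕 u : L2 n), symbolMul hF hb t (𝓕 v : L2 n)⟫_ℂ := by
  rw [semigroupCLM_apply, ← Lp.inner_fourier_eq, FourierTransform.fourier_fourierInv_eq]

theorem inner_semigroupCLM_left (hF : Continuous F) (hb : BddBelow (range F)) (t : ℝ)
    (u v : L2 n) : ⟪semigroupCLM hF hb t u, v⟫_ℂ = ⟪u, semigroupCLM hF hb t v⟫_ℂ := by
  rw [inner_semigroupCLM, semigroupCLM_apply, ← Lp.inner_fourier_eq,
    FourierTransform.fourier_fourierInv_eq, inner_symbolMul_left]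

/-- Joint continuity, from strong continuity and locally uniform boundedness. -/
theorem continuous_uncurry_semigroupCLM (hF : Continuous F) (hb : BddBelow (range F)) :
    Continuous fun p : ℝ × L2 n => semigroupCLM hF hb p.1 p.2 := by
  obtain ⟨c, hc⟩ := id hb
  have hmul : Continuous fun p : ℝ × L2 n => symbolMul hF hb p.1 p.2 := by
    refine continuous_iff_continuousAt.2 fun ⟨t₀, u₀⟩ => ?_
    have h1 : Tendsto (fun p : ℝ × L2 n =>
        Real.exp (max p.1 0 * |c|) * ‖p.2 - u₀‖ + ‖symbolMul hF hb p.1 u₀ - symbolMul hF hb t₀ u₀‖)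
        (𝓝 (t₀, u₀)) (𝓝 0) := by
      have hc1 : Continuous fun p : ℝ × L2 n => Real.exp (max p.1 0 * |c|) * ‖p.2 - u₀‖ +
          ‖symbolMul hF hb p.1 u₀ - symbolMul hF hb t₀ u₀‖ := by
        have := (continuous_symbolMul_apply hF hb u₀).comp (continuous_fst (X := ℝ) (Y := L2 n))
        have h2 : Continuous fun p : ℝ × L2 n => symbolMul hF hb p.1 u₀ := this
        fun_prop
      simpa using hc1.tendsto (t₀, u₀)
    rw [ContinuousAt, tendsto_iff_norm_sub_tendsto_zero]
    refine squeeze_zero (fun _ => norm_nonneg _) (fun p => ?_) h1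
    have h2 : symbolMul hF hb p.1 p.2 - symbolMul hF hb t₀ u₀ =
        symbolMul hF hb p.1 (p.2 - u₀) + (symbolMul hF hb p.1 u₀ - symbolMul hF hb t₀ u₀) := by
      rw [map_sub]
      abel
    rw [h2]
    exact (norm_add_le _ _).trans (add_le_add_left (norm_symbolMul_le hF hb hc _ _) _)
  exact (Lp.fourierTransformₗᵢ (EuclideanSpace ℝ (Fin n)) ℂ).symm.continuous.comp
    (hmul.comp (continuous_fst.prodMk
      ((Lp.fourierTransformₗᵢ (EuclideanSpace ℝ (Fin n)) ℂ).continuous.comp continuous_snd)))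

theorem continuous_semigroupCLM_apply (hF : Continuous F) (hb : BddBelow (range F)) {α : Type*}
    [TopologicalSpace α] {τ : α → ℝ} {w : α → L2 n} (hτ : Continuous τ) (hw : Continuous w) :
    Continuous fun a => semigroupCLM hF hb (τ a) (w a) := by
  have h := continuous_uncurry_semigroupCLM (n := n) hF hb
  exact h.comp₂ hτ hw

/-! ### Extension by zero -/

section Extension

variable {ω : Set (EuclideanSpace ℝ (Fin n))}

theorem coeFn_extendByZero (hω : NullMeasurableSet ω volume) (v : L2On ω) :
    extendByZero hω v =ᵐ[volume] ω.indicator v :=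
  (memLp_indicator hω v).coeFn_toLp

theorem norm_extendByZero (hω : NullMeasurableSet ω volume) (v : L2On ω) :
    ‖extendByZero hω v‖ = ‖v‖ := by
  rw [extendByZero, Lp.norm_toLp, Lp.norm_def]
  congr 1
  have h1 : ω.indicator v =ᵐ[volume] (toMeasurable volume ω).indicator v :=
    indicator_ae_eq_of_ae_eq_set hω.toMeasurable_ae_eq.symm
  rw [eLpNorm_congr_ae h1, eLpNorm_indicator_eq_eLpNorm_restrict (measurableSet_toMeasurable _ _),
    Measure.restrict_congr_set hω.toMeasurable_ae_eq]

theorem indicator_congr_ae_restrict (hω : NullMeasurableSet ω volume)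
    {f g : EuclideanSpace ℝ (Fin n) → ℂ} (h : f =ᵐ[volume.restrict ω] g) :
    ω.indicator f =ᵐ[volume] ω.indicator g := by
  filter_upwards [(ae_restrict_iff'₀ hω).1 h] with x hx
  by_cases hxω : x ∈ ω
  · simp [hxω, hx hxω]
  · simp [hxω]

/-- Extension by zero, as a linear isometry from `L²(ω)` to `L²(ℝⁿ)`. -/
def extendByZeroₗᵢ (hω : NullMeasurableSet ω volume) : L2On ω →ₗᵢ[ℂ] L2 n where
  toFun := extendByZero hω
  map_add' u v := by
    rw [extendByZero, extendByZero, extendByZero, ← MemLp.toLp_add]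
    refine MemLp.toLp_congr _ _ ?_
    rw [← indicator_add']
    exact indicator_congr_ae_restrict hω (Lp.coeFn_add u v)
  map_smul' a v := by
    rw [RingHom.id_apply, extendByZero, extendByZero, ← MemLp.toLp_const_smul]
    refine MemLp.toLp_congr _ _ ?_
    rw [show a • ω.indicator v = ω.indicator (a • ⇑v) from (indicator_const_smul ω a v).symm]
    exact indicator_congr_ae_restrict hω (Lp.coeFn_smul a v)
  norm_map' := norm_extendByZero hω

theorem continuous_extendByZero (hω : NullMeasurableSet ω volume) :
    Continuous (extendByZero hω) :=
  (extendByZeroₗᵢ hω).continuous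

/-- A function orthogonal to all functions supported in `ω` vanishes on `ω`. -/
theorem ae_restrict_eq_zero_of_inner_extendByZero (hω : NullMeasurableSet ω volume) (w : L2 n)
    (h : ∀ v : L2On ω, ⟪extendByZero hω v, w⟫_ℂ = 0) : ∀ᵐ x ∂volume.restrict ω, w x = 0 := by
  set v : L2On ω := ((Lp.memLp w).restrict ω).toLp w with hv
  have hvw : v =ᵐ[volume.restrict ω] w := MemLp.coeFn_toLp _
  have hself : ⟪extendByZero hω v, extendByZero hω v⟫_ℂ = ⟪extendByZero hω v, w⟫_ℂ := by
    rw [L2.inner_def, L2.inner_def]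
    refine integral_congr_ae ?_
    filter_upwards [coeFn_extendByZero hω v, indicator_congr_ae_restrict hω hvw] with x h1 h2
    rw [h1]
    by_cases hx : x ∈ ω
    · rw [indicator_of_mem hx, indicator_of_mem hx] at h2
      rw [indicator_of_mem hx, h2]
    · simp [hx]
  rw [h v, inner_self_eq_zero, ← norm_eq_zero, norm_extendByZero, norm_eq_zero] at hself
  filter_upwards [hvw, Lp.eq_zero_iff_ae_eq_zero.1 hself] with x h1 h2
  rw [← h1, h2, Pi.zero_apply]

end Extension

/-! ### The inverse Fourier transform of integrable functions -/

theorem continuous_fourierInv_of_integrable {p : EuclideanSpace ℝ (Fin n) → ℂ}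
    (hp : Integrable p) : Continuous (𝓕⁻ p) :=
  VectorFourier.fourierIntegral_continuous Real.continuous_fourierChar
    (by simp only [LinearMap.neg_apply, innerₗ_apply_apply]; fun_prop) hp

/-- On `L¹ ∩ L²` the inverse Fourier transform of `L²` is given by the integral. Both functions are
compared as distributions. -/
theorem Lp_fourierInv_ae_eq (u : L2 n) (hu : Integrable u) :
    (𝓕⁻ u : L2 n) =ᵐ[volume] 𝓕⁻ (u : EuclideanSpace ℝ (Fin n) → ℂ) := by
  refine ae_eq_of_integral_contDiff_smul_eq
    ((Lp.memLp (𝓕⁻ u : L2 n)).locallyIntegrable (by norm_num))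
    (continuous_fourierInv_of_integrable hu).locallyIntegrable fun g hg hgc => ?_
  have hgc' : HasCompactSupport fun x => (g x : ℂ) := hgc.comp_left (g := fun r : ℝ => (r : ℂ)) rfl
  let φ : 𝓢(EuclideanSpace ℝ (Fin n), ℂ) :=
    hgc'.toSchwartzMap (Complex.ofRealCLM.contDiff.comp hg)
  have hφ : ∀ x, φ x = (g x : ℂ) := fun x => rfl
  have h1 : ∫ x, φ x • (𝓕⁻ u : L2 n) x = ∫ ξ, (𝓕⁻ φ) ξ • u ξ := by
    rw [← Lp.toTemperedDistribution_apply, ← Lp.fourierInv_toTemperedDistribution_eq,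
      TemperedDistribution.fourierInv_apply, Lp.toTemperedDistribution_apply]
  have h2 : ∫ ξ, (𝓕⁻ φ) ξ • u ξ =
      ∫ x, φ x • (𝓕⁻ (u : EuclideanSpace ℝ (Fin n) → ℂ)) x := by
    rw [SchwartzMap.fourierInv_coe]
    have := VectorFourier.integral_fourierIntegral_smul_eq_flip (e := Real.fourierChar)
      (L := -innerₗ (EuclideanSpace ℝ (Fin n))) (μ := volume) (ν := volume)
      Real.continuous_fourierChar
      (by simp only [LinearMap.neg_apply, innerₗ_apply_apply]; fun_prop) φ.integrable hu
    have hflip : (-innerₗ (EuclideanSpace ℝ (Fin n))).flip = -innerₗ (EuclideanSpace ℝ (Fin n)) :=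
      LinearMap.ext fun x => LinearMap.ext fun y => by simp [real_inner_comm]
    rw [hflip] at this
    exact this
  simpa [hφ, Complex.real_smul] using h1.trans h2

/-- The `k`-th derivative of `s ↦ (𝓕⁻ p) (x + s e)`, as an integral. -/
def lineDerivIntegral (p : EuclideanSpace ℝ (Fin n) → ℂ) (x e : EuclideanSpace ℝ (Fin n)) (k : ℕ)
    (s : ℝ) : ℂ :=
  ∫ ξ, (Complex.exp (2 * Real.pi * ⟪ξ, x + s • e⟫_ℝ * Complex.I) *
    (2 * Real.pi * ⟪ξ, e⟫_ℝ * Complex.I) ^ k) * p ξ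

theorem lineDerivIntegral_zero (p : EuclideanSpace ℝ (Fin n) → ℂ)
    (x e : EuclideanSpace ℝ (Fin n)) (s : ℝ) :
    lineDerivIntegral p x e 0 s = 𝓕⁻ p (x + s • e) := by
  rw [Real.fourierInv_eq', lineDerivIntegral]
  simp

theorem norm_lineDerivIntegral_integrand_le (p : EuclideanSpace ℝ (Fin n) → ℂ)
    {e : EuclideanSpace ℝ (Fin n)} (he : ‖e‖ ≤ 1) (y : EuclideanSpace ℝ (Fin n)) (k : ℕ)
    (ξ : EuclideanSpace ℝ (Fin n)) :
    ‖(Complex.exp (2 * Real.pi * ⟪ξ, y⟫_ℝ * Complex.I) *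
      (2 * Real.pi * ⟪ξ, e⟫_ℝ * Complex.I) ^ k) * p ξ‖ ≤ ‖(2 * Real.pi) • ξ‖ ^ k * ‖p ξ‖ := by
  have h1 : ‖Complex.exp (2 * Real.pi * ⟪ξ, y⟫_ℝ * Complex.I)‖ = 1 := by
    have := Complex.norm_exp_ofReal_mul_I (2 * Real.pi * ⟪ξ, y⟫_ℝ)
    push_cast at this
    exact this
  have h2 : ‖(2 * Real.pi * ⟪ξ, e⟫_ℝ * Complex.I : ℂ)‖ ≤ ‖(2 * Real.pi) • ξ‖ := by
    have hpi : ‖(2 * Real.pi : ℂ)‖ = 2 * Real.pi := by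
      rw [norm_mul, Complex.norm_real, Real.norm_eq_abs, abs_of_pos Real.pi_pos]
      simp
    rw [norm_mul, norm_mul, hpi, Complex.norm_I, mul_one, Complex.norm_real, norm_smul,
      Real.norm_eq_abs (2 * Real.pi), abs_of_pos Real.two_pi_pos]
    refine mul_le_mul_of_nonneg_left ?_ Real.two_pi_pos.le
    exact (norm_inner_le_norm _ _).trans (mul_le_of_le_one_right (norm_nonneg _) he)
  rw [norm_mul, norm_mul, h1, one_mul, norm_pow]
  gcongr

theorem hasDerivAt_lineDerivIntegral {p : EuclideanSpace ℝ (Fin n) → ℂ}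
    (hpm : AEStronglyMeasurable p)
    (hp : ∀ k : ℕ, Integrable fun ξ : EuclideanSpace ℝ (Fin n) => ‖(2 * Real.pi) • ξ‖ ^ k * ‖p ξ‖)
    (x : EuclideanSpace ℝ (Fin n)) {e : EuclideanSpace ℝ (Fin n)} (he : ‖e‖ ≤ 1) (k : ℕ) (s : ℝ) :
    HasDerivAt (lineDerivIntegral p x e k) (lineDerivIntegral p x e (k + 1) s) s := by
  have hmeas : ∀ k (s : ℝ), AEStronglyMeasurable
      (fun ξ : EuclideanSpace ℝ (Fin n) =>
        (Complex.exp (2 * Real.pi * ⟪ξ, x + s • e⟫_ℝ * Complex.I) *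
          (2 * Real.pi * ⟪ξ, e⟫_ℝ * Complex.I) ^ k) * p ξ) volume := fun k s =>
    (Continuous.aestronglyMeasurable (by fun_prop)).mul hpm
  refine (hasDerivAt_integral_of_dominated_loc_of_deriv_le (μ := volume)
    (F := fun (s : ℝ) (ξ : EuclideanSpace ℝ (Fin n)) =>
      (Complex.exp (2 * Real.pi * ⟪ξ, x + s • e⟫_ℝ * Complex.I) *
        (2 * Real.pi * ⟪ξ, e⟫_ℝ * Complex.I) ^ k) * p ξ)
    (F' := fun (s : ℝ) (ξ : EuclideanSpace ℝ (Fin n)) =>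
      (Complex.exp (2 * Real.pi * ⟪ξ, x + s • e⟫_ℝ * Complex.I) *
        (2 * Real.pi * ⟪ξ, e⟫_ℝ * Complex.I) ^ (k + 1)) * p ξ)
    (s := univ) univ_mem (Eventually.of_forall (hmeas k)) ?_ (hmeas (k + 1) s)
    (Eventually.of_forall fun ξ s _ => norm_lineDerivIntegral_integrand_le p he _ _ _) (hp (k + 1))
    (Eventually.of_forall fun ξ s _ => ?_)).2
  · exact (hp k).mono' (hmeas k s)
      (Eventually.of_forall fun ξ => norm_lineDerivIntegral_integrand_le p he _ _ _)
  · have h0 : HasDerivAt (fun s : ℝ => ⟪ξ, x + s • e⟫_ℝ) ⟪ξ, e⟫_ℝ s := by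
      have : (fun s : ℝ => ⟪ξ, x + s • e⟫_ℝ) = fun s => ⟪ξ, x⟫_ℝ + s * ⟪ξ, e⟫_ℝ := by
        ext s
        rw [inner_add_right, real_inner_smul_right]
      rw [this]
      simpa using ((hasDerivAt_id s).mul_const ⟪ξ, e⟫_ℝ).const_add ⟪ξ, x⟫_ℝ
    have h1 := ((h0.ofReal_comp.const_mul (2 * Real.pi : ℂ)).mul_const Complex.I).cexp
    convert! (h1.mul_const ((2 * Real.pi * ⟪ξ, e⟫_ℝ * Complex.I : ℂ) ^ k)).mul_const (p ξ) using 1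
    ring

theorem norm_lineDerivIntegral_le (p : EuclideanSpace ℝ (Fin n) → ℂ)
    (x : EuclideanSpace ℝ (Fin n)) {e : EuclideanSpace ℝ (Fin n)} (he : ‖e‖ ≤ 1) {k : ℕ}
    (hp : Integrable fun ξ : EuclideanSpace ℝ (Fin n) => ‖(2 * Real.pi) • ξ‖ ^ k * ‖p ξ‖) (s : ℝ) :
    ‖lineDerivIntegral p x e k s‖ ≤ ∫ ξ, ‖(2 * Real.pi) • ξ‖ ^ k * ‖p ξ‖ :=
  norm_integral_le_of_norm_le hp
    (Eventually.of_forall fun _ => norm_lineDerivIntegral_integrand_le p he _ _ _)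

/-- If the moments of `|p|` are dominated by a quasi-analytic sequence, then `𝓕⁻ p` is not zero on a
set of positive measure unless `p` is zero: quasi-analyticity propagates the zeros of `𝓕⁻ p` along
lines parallel to the axes. -/
theorem fourierInv_eq_zero_of_volume_zeroSet_pos {M : ℕ → ℝ} (hM : IsQuasiAnalytic M)
    (hM0 : ∀ k, 0 ≤ M k) {p : EuclideanSpace ℝ (Fin n) → ℂ} (hpm : AEStronglyMeasurable p)
    (hp : ∀ k : ℕ, Integrable fun ξ : EuclideanSpace ℝ (Fin n) => ‖(2 * Real.pi) • ξ‖ ^ k * ‖p ξ‖)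
    {C : ℝ} (hC : ∀ k : ℕ, ∫ ξ, ‖(2 * Real.pi) • ξ‖ ^ k * ‖p ξ‖ ≤ C * M k)
    (hpos : 0 < volume {x | 𝓕⁻ p x = 0}) (x : EuclideanSpace ℝ (Fin n)) : 𝓕⁻ p x = 0 := by
  have hpi : Integrable p := (integrable_norm_iff hpm).1 (by simpa using hp 0)
  have hline : ∀ (x e : EuclideanSpace ℝ (Fin n)), ‖e‖ ≤ 1 →
      0 < volume {s : ℝ | 𝓕⁻ p (x + s • e) = 0} → ∀ s : ℝ, 𝓕⁻ p (x + s • e) = 0 := by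
    intro x e he h s
    -- Dividing by `K` puts the function into the class of `M`; the maximum with `1` avoids `C = 0`.
    set K : ℝ := max C 1 with hK
    have hK0 : 0 < K := zero_lt_one.trans_le (le_max_right _ _)
    have hKC : (K : ℂ) ≠ 0 := by exact_mod_cast hK0.ne'
    have hset : {s : ℝ | (K : ℂ)⁻¹ * lineDerivIntegral p x e 0 s = 0} =
        {s : ℝ | 𝓕⁻ p (x + s • e) = 0} := by
      ext s
      simp [lineDerivIntegral_zero, hKC]
    have := hM.eq_zero_of_volume_zeroSet_pos
      (fun k s => (K : ℂ)⁻¹ * lineDerivIntegral p x e k s)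
      (fun k s => (hasDerivAt_lineDerivIntegral hpm hp x he k s).const_mul _)
      (fun k s => by
        rw [norm_mul, norm_inv, Complex.norm_real, Real.norm_eq_abs, abs_of_pos hK0,
          inv_mul_le_iff₀ hK0]
        exact (norm_lineDerivIntegral_le p x he (hp k) s).trans
          ((hC k).trans (mul_le_mul_of_nonneg_right (le_max_left _ _) (hM0 k))))
      (by rw [hset]; exact h) s
    simpa [lineDerivIntegral_zero, hKC] using this
  have hupd : ∀ (y : Fin n → ℝ) (i : Fin n) (s : ℝ), WithLp.toLp 2 (Function.update y i s) =
      WithLp.toLp 2 (Function.update y i 0) + s • EuclideanSpace.single i (1 : ℝ) := by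
    intro y i s
    ext j
    by_cases hj : j = i
    · subst hj
      simp
    · simp [hj]
  have hpres := (PiLp.volume_preserving_toLp (Fin n))
  have hclosed : IsClosed {x | 𝓕⁻ p x = 0} :=
    isClosed_eq (continuous_fourierInv_of_integrable hpi) continuous_const
  have huniv := eq_univ_of_forall_update_mem n
    ((WithLp.toLp 2 : (Fin n → ℝ) → EuclideanSpace ℝ (Fin n)) ⁻¹' {x | 𝓕⁻ p x = 0})
    (hclosed.preimage (PiLp.continuous_toLp 2 _))
    (by rwa [hpres.measure_preimage hclosed.measurableSet.nullMeasurableSet])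
    (fun y i h s => by
      rw [mem_preimage, hupd]
      refine hline _ _ (by simp) (h.trans_le (measure_mono fun r hr => ?_)) s
      rwa [mem_ofPred_eq, mem_preimage, hupd] at hr)
  simpa using (Set.ext_iff.1 huniv (WithLp.ofLp x)).2 (mem_univ _)

/-! ### Unique continuation for the semigroup -/

theorem pow_mul_exp_neg_le_weightSeq (hM : HasPositiveRealWeightSeq F) (k : ℕ) (r : ℝ≥0) :
    (r : ℝ) ^ k * Real.exp (-F r) ≤ weightSeq F k :=
  le_ciSup (hM k).1 r

/-- The symbol `exp (-F)` is square integrable: it is bounded by `M_0`, and it decays like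
`(1 + |ξ|) ^ (-(n + 1))` because `M_{n + 1}` is finite. -/
theorem memLp_two_symbol_one (hF : Continuous F) (hM : HasPositiveRealWeightSeq F) :
    MemLp (symbol F 1 : EuclideanSpace ℝ (Fin n) → ℂ) 2 volume := by
  have hsm : AEStronglyMeasurable (symbol F 1 : EuclideanSpace ℝ (Fin n) → ℂ) volume :=
    (continuous_symbol hF 1).aestronglyMeasurable
  have hbound : ∀ (k : ℕ) (ξ : EuclideanSpace ℝ (Fin n)),
      ‖(2 * Real.pi) • ξ‖ ^ k * ‖symbol F 1 ξ‖ ≤ weightSeq F k := fun k ξ => by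
    rw [norm_symbol, neg_one_mul]
    exact pow_mul_exp_neg_le_weightSeq hM k ‖(2 * Real.pi) • ξ‖₊
  rw [memLp_two_iff_integrable_sq_norm hsm]
  set C := weightSeq F 0 * (2 ^ (n + 1) * (weightSeq F 0 + weightSeq F (n + 1)))
  have hint : Integrable (fun ξ : EuclideanSpace ℝ (Fin n) => (1 + ‖ξ‖) ^ (-((n + 1 : ℕ) : ℝ))) :=
    integrable_one_add_norm (by simp)
  refine (hint.const_mul C).mono' (hsm.norm.pow 2) (Eventually.of_forall fun ξ => ?_)
  have h0 : ‖symbol F 1 ξ‖ ≤ weightSeq F 0 := by simpa using hbound 0 ξ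
  have h1 : ‖ξ‖ ≤ ‖(2 * Real.pi) • ξ‖ := by
    rw [norm_smul, Real.norm_eq_abs, abs_of_pos Real.two_pi_pos]
    exact le_mul_of_one_le_left (norm_nonneg _) (by linarith [Real.two_le_pi])
  have h2 : (1 + ‖ξ‖) ^ (n + 1) ≤ 2 ^ (n + 1) * (1 + ‖(2 * Real.pi) • ξ‖ ^ (n + 1)) := by
    have h3 : 1 + ‖ξ‖ ≤ 2 * max 1 ‖(2 * Real.pi) • ξ‖ := by
      linarith [le_max_left 1 ‖(2 * Real.pi) • ξ‖, le_max_right 1 ‖(2 * Real.pi) • ξ‖]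
    refine (pow_le_pow_left₀ (by positivity) h3 _).trans ?_
    rw [mul_pow]
    gcongr
    rcases max_choice 1 ‖(2 * Real.pi) • ξ‖ with h | h <;> rw [h]
    · rw [one_pow]
      linarith [pow_nonneg (norm_nonneg ((2 * Real.pi) • ξ)) (n + 1)]
    · linarith
  have h3 : (1 + ‖ξ‖) ^ (n + 1) * ‖symbol F 1 ξ‖ ≤
      2 ^ (n + 1) * (weightSeq F 0 + weightSeq F (n + 1)) := by
    refine (mul_le_mul_of_nonneg_right h2 (norm_nonneg _)).trans ?_
    rw [mul_assoc, add_mul, one_mul]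
    gcongr
    exact hbound _ ξ
  rw [Real.norm_eq_abs, abs_of_nonneg (by positivity), Real.rpow_neg (by positivity),
    Real.rpow_natCast, ← div_eq_mul_inv, le_div_iff₀ (by positivity)]
  calc ‖symbol F 1 ξ‖ ^ 2 * (1 + ‖ξ‖) ^ (n + 1)
      = ‖symbol F 1 ξ‖ * ((1 + ‖ξ‖) ^ (n + 1) * ‖symbol F 1 ξ‖) := by ring
    _ ≤ C := mul_le_mul h0 h3 (by positivity) (hM 0).2.le

/-- Unique continuation for `exp (-2 F(|D|)) g`. One factor `exp (-F)` of the symbol supplies the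
weights `M_k`, the other one makes the moments converge. -/
theorem eq_zero_of_semigroupCLM_two_ae_eq_zero (hF : Continuous F) (hb : BddBelow (range F))
    (hM : HasPositiveRealWeightSeq F) (hqa : IsQuasiAnalytic (weightSeq F))
    {ω : Set (EuclideanSpace ℝ (Fin n))} (hω : NullMeasurableSet ω volume) (hpos : 0 < volume ω)
    (g : L2 n) (hg : ∀ᵐ x ∂volume.restrict ω, semigroupCLM hF hb 2 g x = 0) : g = 0 := by
  set P : L2 n := symbolMul hF hb 2 (𝓕 g : L2 n) with hP
  have hPae : P =ᵐ[volume] fun ξ => symbol F 2 ξ * (𝓕 g : L2 n) ξ := by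
    have := coeFn_symbolMul hF hb 2 (𝓕 g : L2 n)
    rwa [max_eq_left zero_le_two] at this
  have hsymbol : ∀ ξ : EuclideanSpace ℝ (Fin n), symbol F 2 ξ = symbol F 1 ξ * symbol F 1 ξ :=
    fun ξ => by
      rw [symbol, symbol, ← Complex.ofReal_mul, ← Real.exp_add]
      ring_nf
  have hq : Integrable (fun ξ : EuclideanSpace ℝ (Fin n) => symbol F 1 ξ * (𝓕 g : L2 n) ξ) :=
    (memLp_two_symbol_one hF hM).integrable_mul (Lp.memLp (𝓕 g : L2 n))
  have hle : ∀ k : ℕ, ∀ᵐ ξ : EuclideanSpace ℝ (Fin n), ‖(2 * Real.pi) • ξ‖ ^ k * ‖P ξ‖ ≤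
      weightSeq F k * ‖symbol F 1 ξ * (𝓕 g : L2 n) ξ‖ := by
    intro k
    filter_upwards [hPae] with ξ hξ
    rw [hξ, hsymbol, mul_assoc, norm_mul, ← mul_assoc]
    refine mul_le_mul_of_nonneg_right ?_ (norm_nonneg _)
    rw [norm_symbol, neg_one_mul]
    exact pow_mul_exp_neg_le_weightSeq hM k ‖(2 * Real.pi) • ξ‖₊
  have hPm : AEStronglyMeasurable P volume := Lp.aestronglyMeasurable P
  have hmom : ∀ k : ℕ,
      Integrable fun ξ : EuclideanSpace ℝ (Fin n) => ‖(2 * Real.pi) • ξ‖ ^ k * ‖P ξ‖ := by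
    intro k
    refine (hq.norm.const_mul (weightSeq F k)).mono'
      ((Continuous.aestronglyMeasurable (by fun_prop)).mul hPm.norm) ?_
    filter_upwards [hle k] with ξ hξ
    rwa [Real.norm_eq_abs, abs_of_nonneg (by positivity)]
  have hPi : Integrable P := (integrable_norm_iff hPm).1 (by simpa using hmom 0)
  have hrep : semigroupCLM hF hb 2 g =ᵐ[volume] 𝓕⁻ (P : EuclideanSpace ℝ (Fin n) → ℂ) :=
    Lp_fourierInv_ae_eq P hPi
  have hzero : 0 < volume {x | 𝓕⁻ (P : EuclideanSpace ℝ (Fin n) → ℂ) x = 0} := by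
    refine hpos.trans_le (measure_mono_ae ?_)
    filter_upwards [hrep, (ae_restrict_iff'₀ hω).1 hg] with x h1 h2 hx
    exact h1.symm.trans (h2 hx)
  have hall := fourierInv_eq_zero_of_volume_zeroSet_pos hqa (fun k => (hM k).2.le) hPm hmom
    (C := ∫ ξ : EuclideanSpace ℝ (Fin n), ‖symbol F 1 ξ * (𝓕 g : L2 n) ξ‖) (fun k => by
      rw [mul_comm (integral _ _), ← integral_const_mul]
      exact integral_mono_ae (hmom k) (hq.norm.const_mul _) (hle k)) hzero
  have hP0 : P = 0 := by
    refine (Lp.fourierTransformₗᵢ (EuclideanSpace ℝ (Fin n)) ℂ).symm.map_eq_zero_iff.1 ?_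
    rw [Lp.eq_zero_iff_ae_eq_zero]
    filter_upwards [Lp_fourierInv_ae_eq P hPi] with x hx
    exact hx.trans (hall x)
  have hg0 : (𝓕 g : L2 n) = 0 := by
    rw [Lp.eq_zero_iff_ae_eq_zero]
    filter_upwards [hPae, Lp.eq_zero_iff_ae_eq_zero.1 hP0] with ξ h1 h2
    rw [h1, Pi.zero_apply] at h2
    refine (mul_eq_zero.1 h2).resolve_left (norm_ne_zero_iff.1 ?_)
    rw [norm_symbol]
    exact (Real.exp_pos _).ne'
  exact (Lp.fourierTransformₗᵢ (EuclideanSpace ℝ (Fin n)) ℂ).map_eq_zero_iff.1 hg0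

/-! ### Reachable states -/

variable {ω : Set (EuclideanSpace ℝ (Fin n))}

/-- For a continuous control the Duhamel integrand is jointly continuous in both times, also where
`p.1 < p.2`, thanks to the truncation in `semigroupCLM`. -/
theorem continuous_uncurry_duhamel (hF : Continuous F) (hb : BddBelow (range F))
    (hω : NullMeasurableSet ω volume) {h : ℝ → L2On ω} (hh : Continuous h) :
    Continuous fun p : ℝ × ℝ => semigroupCLM hF hb (p.1 - p.2) (extendByZero hω (h p.2)) :=
  continuous_semigroupCLM_apply hF hb (continuous_fst.sub continuous_snd)
    ((continuous_extendByZero hω).comp (hh.comp continuous_snd))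

theorem intervalIntegrable_duhamel (hF : Continuous F) (hb : BddBelow (range F))
    (hω : NullMeasurableSet ω volume) {h : ℝ → L2On ω} (hh : Continuous h) (t : ℝ) :
    IntervalIntegrable (fun s => semigroupCLM hF hb (t - s) (extendByZero hω (h s)))
      volume 0 t :=
  Continuous.intervalIntegrable (continuous_semigroupCLM_apply hF hb
    (continuous_const.sub continuous_id) ((continuous_extendByZero hω).comp hh)) 0 t

/-- The state reached at time `T` from the initial state `0`, as a function of the continuous
control. -/
def reachMap (hF : Continuous F) (hb : BddBelow (range F)) (hω : NullMeasurableSet ω volume)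
    (T : ℝ) : C(ℝ, L2On ω) →ₗ[ℂ] L2 n where
  toFun h := ∫ s in (0 : ℝ)..T, semigroupCLM hF hb (T - s) (extendByZero hω (h s))
  map_add' h₁ h₂ := by
    rw [← intervalIntegral.integral_add (intervalIntegrable_duhamel hF hb hω h₁.continuous T)
      (intervalIntegrable_duhamel hF hb hω h₂.continuous T)]
    refine intervalIntegral.integral_congr fun s _ => ?_
    exact (congrArg _ ((extendByZeroₗᵢ hω).map_add _ _)).trans (map_add _ _ _)
  map_smul' a h := by
    rw [RingHom.id_apply, ← intervalIntegral.integral_smul]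
    refine intervalIntegral.integral_congr fun s _ => ?_
    exact (congrArg _ ((extendByZeroₗᵢ hω).map_smul _ _)).trans (map_smul _ _ _)

/-- Duality: a state orthogonal to all reachable states has an adjoint evolution that vanishes on
`ω`. This follows by testing with the control `s ↦ 1_ω exp (-(T - s) F(|D|)) g`. -/
theorem inner_semigroupCLM_eq_zero_of_orthogonal (hF : Continuous F) (hb : BddBelow (range F))
    (hω : NullMeasurableSet ω volume) {T : ℝ} (hT : 0 < T) {g : L2 n}
    (hg : ∀ h : C(ℝ, L2On ω), ⟪g, reachMap hF hb hω T h⟫_ℂ = 0) (v : L2On ω) {t : ℝ}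
    (ht : t ∈ Icc 0 T) : ⟪extendByZero hω v, semigroupCLM hF hb t g⟫_ℂ = 0 := by
  let B : L2On ω →L[ℂ] L2 n := (extendByZeroₗᵢ hω).toContinuousLinearMap
  have hB : ∀ v, B v = extendByZero hω v := fun v => rfl
  have hcont : Continuous fun s : ℝ =>
      ContinuousLinearMap.adjoint B (semigroupCLM hF hb (T - s) g) :=
    (ContinuousLinearMap.adjoint B).continuous.comp
      (continuous_semigroupCLM_apply hF hb (continuous_const.sub continuous_id) continuous_const)
  let h : C(ℝ, L2On ω) := ⟨_, hcont⟩
  have hh : ∀ s, h s = ContinuousLinearMap.adjoint B (semigroupCLM hF hb (T - s) g) := fun s => rfl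
  have hpoint : ∀ s, ⟪g, semigroupCLM hF hb (T - s) (extendByZero hω (h s))⟫_ℂ =
      ((‖h s‖ ^ 2 : ℝ) : ℂ) := by
    intro s
    rw [← inner_semigroupCLM_left, ← hB, ← ContinuousLinearMap.adjoint_inner_left, ← hh,
      inner_self_eq_norm_sq_to_K]
    push_cast
    rfl
  have hint : IntervalIntegrable
      (fun s => semigroupCLM hF hb (T - s) (extendByZero hω (h s))) volume 0 T :=
    intervalIntegrable_duhamel hF hb hω h.continuous T
  have hzero : ∫ s in (0 : ℝ)..T, ‖h s‖ ^ 2 = 0 := by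
    have h1 := hg h
    have h2 : ⟪g, reachMap hF hb hω T h⟫_ℂ =
        ∫ s in (0 : ℝ)..T, ⟪g, semigroupCLM hF hb (T - s) (extendByZero hω (h s))⟫_ℂ :=
      ((innerSL ℂ g).intervalIntegral_comp_comm hint).symm
    simp only [h2, hpoint] at h1
    rw [intervalIntegral.integral_ofReal] at h1
    exact_mod_cast h1
  have hvanish : ∀ s ∈ Icc 0 T, h s = 0 := by
    intro s hs
    by_contra hne
    refine (intervalIntegral.integral_pos hT ?_ (fun x _ => by positivity)
      ⟨s, hs, ?_⟩).ne' hzero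
    · exact (h.continuous.norm.pow 2).continuousOn
    · exact pow_pos (norm_pos_iff.2 hne) 2
  have := hvanish (T - t) ⟨by linarith [ht.2], by linarith [ht.1]⟩
  rw [hh, sub_sub_cancel] at this
  rw [← hB, ← ContinuousLinearMap.adjoint_inner_right, this, inner_zero_right]

/-- Analyticity in time turns the vanishing of `exp (-t F(|D|)) g` on `ω` for `t ∈ (0, T)` into the
vanishing for all `t > 0`. -/
theorem inner_semigroupCLM_eq_zero_of_Ioo (hF : Continuous F) (hb : BddBelow (range F)) {T : ℝ}
    (hT : 0 < T) {u g : L2 n} (h : ∀ t ∈ Ioo 0 T, ⟪u, semigroupCLM hF hb t g⟫_ℂ = 0) {t : ℝ}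
    (ht : 0 < t) : ⟪u, semigroupCLM hF hb t g⟫_ℂ = 0 := by
  obtain ⟨c, hc⟩ := id hb
  have hform : ∀ s : ℝ, 0 < s → ⟪u, semigroupCLM hF hb s g⟫_ℂ =
      ∫ ξ, ((Real.exp (-s * F ‖(2 * Real.pi) • ξ‖₊) : ℝ) : ℂ) *
        ⟪(𝓕 u : L2 n) ξ, (𝓕 g : L2 n) ξ⟫_ℂ := fun s hs => by
    rw [inner_semigroupCLM, inner_symbolMul, max_eq_left hs.le]
  rw [hform t ht]
  refine integral_exp_neg_mul_eq_zero (φ := fun ξ => F ‖(2 * Real.pi) • ξ‖₊)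
    (Continuous.measurable (by fun_prop)) (fun ξ => hc (mem_range_self _))
    (L2.integrable_inner _ _) hT (fun s hs => ?_) ht
  rw [← hform s hs.1]
  exact h s hs

theorem denseRange_reachMap (hF : Continuous F) (hb : BddBelow (range F))
    (hω : NullMeasurableSet ω volume) (hpos : 0 < volume ω) (hM : HasPositiveRealWeightSeq F)
    (hqa : IsQuasiAnalytic (weightSeq F)) {T : ℝ} (hT : 0 < T) :
    DenseRange (reachMap hF hb hω T) := by
  have htop : (LinearMap.range (reachMap hF hb hω T)).topologicalClosure = ⊤ := by
    rw [Submodule.topologicalClosure_eq_top_iff, Submodule.eq_bot_iff]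
    intro g hg
    have hg' : ∀ h : C(ℝ, L2On ω), ⟪g, reachMap hF hb hω T h⟫_ℂ = 0 := fun h =>
      Submodule.inner_left_of_mem_orthogonal (LinearMap.mem_range_self _ h) hg
    refine eq_zero_of_semigroupCLM_two_ae_eq_zero hF hb hM hqa hω hpos g ?_
    refine ae_restrict_eq_zero_of_inner_extendByZero hω _ fun v => ?_
    refine inner_semigroupCLM_eq_zero_of_Ioo hF hb hT (fun t ht => ?_) two_pos
    exact inner_semigroupCLM_eq_zero_of_orthogonal hF hb hω hT hg' v (Ioo_subset_Icc_self ht)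
  have := Submodule.dense_iff_topologicalClosure_eq_top.2 htop
  exact this

/-- A continuous control, restricted to `(0, T)`, has a mild solution given by Duhamel's formula. -/
theorem exists_isMildSolution_of_continuous (hF : Continuous F) (hb : BddBelow (range F))
    (hω : NullMeasurableSet ω volume) {T : ℝ} (f₀ : L2 n) (h : C(ℝ, L2On ω)) :
    ∃ (u : Control ω T) (f : ℝ → L2 n), IsMildSolution F hω T f₀ u f ∧
      f T = semigroupCLM hF hb T f₀ + reachMap hF hb hω T h := by
  have hmem : MemLp h 2 (volume.restrict (Ioo 0 T)) := by
    obtain ⟨C, hC⟩ := isCompact_Icc.exists_bound_of_continuousOn (h.continuous.continuousOn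
      (s := Icc 0 T))
    refine MemLp.of_bound h.continuous.aestronglyMeasurable C ?_
    filter_upwards [ae_restrict_mem measurableSet_Ioo] with s hs
    exact hC s (Ioo_subset_Icc_self hs)
  have hcont := continuous_uncurry_duhamel hF hb hω h.continuous
  have hae : ∀ t ∈ Icc 0 T,
      (fun s => semigroupCLM hF hb (t - s) (extendByZero hω (h s)))
        =ᵐ[volume.restrict (uIoc 0 t)]
      fun s => semigroup F (t - s) (extendByZero hω (hmem.toLp h s)) := by
    intro t ht
    rw [uIoc_of_le ht.1, ← Measure.restrict_congr_set Ioo_ae_eq_Ioc]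
    have h1 : ∀ᵐ s ∂volume.restrict (Ioo 0 t), hmem.toLp h s = h s :=
      ae_mono (Measure.restrict_mono (Ioo_subset_Ioo_right ht.2) le_rfl) hmem.coeFn_toLp
    filter_upwards [h1, ae_restrict_mem measurableSet_Ioo] with s hs hs'
    rw [hs, semigroup_eq_semigroupCLM hF hb (by linarith [hs'.2])]
  refine ⟨hmem.toLp h, fun t => semigroupCLM hF hb t f₀ +
    ∫ s in (0 : ℝ)..t, semigroupCLM hF hb (t - s) (extendByZero hω (h s)), ⟨?_, fun t ht => ⟨?_, ?_⟩⟩,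
    rfl⟩
  · refine Continuous.continuousOn (Continuous.add ?_ ?_)
    · exact continuous_semigroupCLM_apply hF hb continuous_id continuous_const
    · exact intervalIntegral.continuous_parametric_intervalIntegral_of_continuous hcont
        continuous_id
  · exact (intervalIntegrable_duhamel hF hb hω h.continuous t).congr_ae (hae t ht)
  · rw [semigroup_eq_semigroupCLM hF hb ht.1]
    exact congrArg _ (intervalIntegral.integral_congr_ae_restrict (hae t ht))

end DiffusiveControl

end

theorem mainTheorem5 (n : ℕ) (F : ℝ≥0 → ℝ) (hF : Continuous F) (hFb : BddBelow (range F))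
    (ω : Set (EuclideanSpace ℝ (Fin n))) (hω : NullMeasurableSet ω volume) (hpos : 0 < volume ω)
    (hM : DiffusiveControl.HasPositiveRealWeightSeq F)
    (hqa : DiffusiveControl.IsQuasiAnalytic (DiffusiveControl.weightSeq F))
    (T : ℝ) (hT : 0 < T) :
    DiffusiveControl.ApproxNullControllable F hω T := by
  intro ε hε f₀
  obtain ⟨h, hh⟩ := (DiffusiveControl.denseRange_reachMap hF hFb hω hpos hM hqa hT).exists_dist_lt
    (-DiffusiveControl.semigroupCLM hF hFb T f₀) hε
  obtain ⟨u, f, hf, hfT⟩ :=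
    DiffusiveControl.exists_isMildSolution_of_continuous hF hFb hω f₀ h
  refine ⟨u, f, hf, ?_⟩
  rw [dist_comm, dist_eq_norm, sub_neg_eq_add, add_comm] at hh
  rw [hfT]
  exact hh.le
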